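/- **Theorem 3.** Let $\varphi$ be an Orlicz N-function, i.e. an even convex continuous function on $\mathbb R$ with $\varphi(0)=0$, $\varphi(x)>0$ for $x\ne 0$, $\varphi(x)/x\to 0$ as $x\to 0$ and $\varphi(x)/x\to\infty$ as $x\to\infty$, such that $\lim_{x\to0}\varphi(x)/x^2$ exists in $(0,\infty]$, and suppose that $\varphi(t)=t^\zeta/\zeta$ for all $t>1$, where $\zeta\ge 2$. For a random variable $\xi$ put $\tau_\varphi(\xi)=\inf\{a\ge 0:\ E e^{\lambda\xi}\le e^{\varphi(a\lambda)}\text{ for all }\lambda\in\mathbb R\}$; $\xi$ is called $\varphi$-sub-Gaussian if the set on the right is non-empty. Let $(B,\rho)$ be a compact metric space with at least two points, and let $X=\{X(t),\,t\in B\}$ be a real stochastic process on a probability space, separable on $(B,\rho)$, all of whose values $X(t)$ are $\varphi$-sub-Gaussian. (Separable means: there are a countable dense set $S\subset B$ and a null event $N$ such that outside $N$, for every open $U\subset B$ and closed $D\subset\mathbb R$, if $X(t)\in D$ for all $t\in U\cap S$ then $X(t)\in D$ for all $t\in U$.) Let $\sigma$ be a continuous nondecreasing function on $(0,\infty)$ with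 $\sigma(h)\to0$ as $h\to 0$ and $$\sup_{\rho(t,s)\le h}\tau_\varphi\bigl(X(t)-X(s)\bigr)\le\sigma(h),\qquad h>0 .$$ Suppose that $\beta:=\sigma\bigl(\inf_{s\in B}\sup_{t\in B}\rho(t,s)\bigr)>0$. Let $\sigma^{(-1)}(u)=\sup\{h>0:\sigma(h)\le u\}$ (the usual inverse function if $\sigma$ is strictly increasing), and let $N_B(u)$ be the least number of closed balls of radius $u$ that cover $B$. Let $r_1$ be a continuous strictly increasing function on $[1,\infty)$ with $r_1(u)>0$ for $u>1$ such that $t\mapsto r_1(e^t)$ is convex on $(0,\infty)$, let $r_1^{(-1)}$ be its inverse function, and assume $$\int_0^{\beta} r_1\bigl(N_B(\sigma^{(-1)}(u))\bigr)\,du<\infty .$$ Let $\gamma\ge0$ be defined by $\gamma^\zeta=\sup_{u\in B}\tau_\varphi(X(u))^\zeta$, and let $v=\min\{\beta,\gamma\}$. Then $X$ is bounded with probability $1$, and for all $p\in(0,1)$ and all $$x>\frac{\gamma^\zeta(1-p)+p\beta^\zeta}{(1-p)\,v^{\zeta-1}}$$ (the right-hand side is $+\infty$, so that there is no such $x$,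 if $v=0$) the following inequalities hold: $$P\Bigl\{\sup_{t\in B}X(t)>x\Bigr\}\le Z,\qquad P\Bigl\{\inf_{t\in B}X(t)<-x\Bigr\}\le Z,\qquad P\Bigl\{\sup_{t\in B}|X(t)|>x\Bigr\}\le 2Z,$$ where $$Z=\exp\left\{\frac{(1-\zeta)\,(x(1-p))^{\frac{\zeta}{\zeta-1}}}{\zeta\,\bigl(\gamma^\zeta(1-p)+p\beta^\zeta\bigr)^{\frac1{\zeta-1}}}\right\}\; r_1^{(-1)}\!\left(\frac1{\beta p}\int_0^{\beta p} r_1\bigl(N_B(\sigma^{(-1)}(u))\bigr)\,du\right).$$ (Probabilities of events that need not be measurable are understood as outer probabilities.) -/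

import Mathlib

open MeasureTheory Filter Set Topology
open scoped NNReal

noncomputable section

/-- Orlicz N-functions. -/
structure IsOrliczNFunction (φ : ℝ → ℝ) : Prop where
  even : ∀ x, φ (-x) = φ x
  convex : ConvexOn ℝ univ φ
  continuous : Continuous φ
  map_zero : φ 0 = 0
  pos : ∀ x, x ≠ 0 → 0 < φ x
  tendsto_zero : Tendsto (fun x => φ x / x) (𝓝[≠] 0) (𝓝 0)
  tendsto_atTop : Tendsto (fun x => φ x / x) atTop atTop

/-- Assumption Q on an N-function: `φ x / x ^ 2` has a limit in `(0, ∞]` as `x → 0`. -/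
def AssumptionQ (φ : ℝ → ℝ) : Prop :=
  (∃ c : ℝ, 0 < c ∧ Tendsto (fun x => φ x / x ^ 2) (𝓝[≠] 0) (𝓝 c)) ∨
    Tendsto (fun x => φ x / x ^ 2) (𝓝[≠] 0) atTop

section

variable {Ω : Type*} [MeasurableSpace Ω]

/-- `E exp (l ξ) ≤ exp (φ (a l))` for all real `l`; the expectation is required to be finite. -/
def ExpMomentBound (φ : ℝ → ℝ) (P : Measure Ω) (ξ : Ω → ℝ) (a : ℝ) : Prop :=
  ∀ l : ℝ, Integrable (fun ω => Real.exp (l * ξ ω)) P ∧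
    ∫ ω, Real.exp (l * ξ ω) ∂P ≤ Real.exp (φ (a * l))

/-- `ξ` is a `φ`-sub-Gaussian random variable. -/
def IsPhiSubGaussian (φ : ℝ → ℝ) (P : Measure Ω) (ξ : Ω → ℝ) : Prop :=
  Measurable ξ ∧ ∃ a : ℝ, 0 ≤ a ∧ ExpMomentBound φ P ξ a

/-- The `φ`-sub-Gaussian standard `τ_φ(ξ)`. -/
def subGaussianStandard (φ : ℝ → ℝ) (P : Measure Ω) (ξ : Ω → ℝ) : ℝ :=
  sInf {a : ℝ | 0 ≤ a ∧ ExpMomentBound φ P ξ a}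

/-- Separability of a process `X` indexed by a topological space: there are a countable dense set
`S` of times and a null set `N` such that, for every open `U` and every closed `D`, the events
`{X t ∈ D for all t ∈ U ∩ S}` and `{X t ∈ D for all t ∈ U}` agree outside `N`. -/
def IsSeparableProcess {B : Type*} [TopologicalSpace B] (P : Measure Ω) (X : B → Ω → ℝ) : Prop :=
  ∃ S : Set B, S.Countable ∧ Dense S ∧ ∃ N : Set Ω, P N = 0 ∧
    ∀ U : Set B, IsOpen U → ∀ D : Set ℝ, IsClosed D → ∀ ω, ω ∉ N →
      (∀ t ∈ U ∩ S, X t ω ∈ D) → ∀ t ∈ U, X t ω ∈ D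

end

/-- The metric massiveness `N_B(u)`: the least number of closed balls of radius `u` that cover
the metric space `B`. -/
def metricMassiveness (B : Type*) [MetricSpace B] (u : ℝ) : ℕ :=
  (Metric.coveringNumber u.toNNReal (univ : Set B)).toNat

/-- The (right) inverse on `D` of an increasing function `f`: the largest `h ∈ D` with `f h ≤ u`.
If `f` is continuous and strictly increasing on `D` and takes the value `u` there, this is the
unique `h ∈ D` with `f h = u` (see `inverseOn_apply`). -/
def inverseOn (D : Set ℝ) (f : ℝ → ℝ) (u : ℝ) : ℝ :=
  sSup {h | h ∈ D ∧ f h ≤ u}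

theorem inverseOn_apply {D : Set ℝ} {f : ℝ → ℝ} (hf : StrictMonoOn f D) {h : ℝ} (hh : h ∈ D) :
    inverseOn D f (f h) = h := by
  have : IsGreatest {k | k ∈ D ∧ f k ≤ f h} h :=
    ⟨⟨hh, le_rfl⟩, fun k hk => (hf.le_iff_le hk.1 hh).1 hk.2⟩
  exact this.csSup_eq

/-- The entropy factor
`r⁻¹ ( (β p)⁻¹ ∫_0^{β p} r (N_B (σ⁻¹ u)) du )`,
for `σ` defined on `(0, ∞)` and `r` defined on `[1, ∞)`. -/
def entropyFactor (B : Type*) [MetricSpace B] (σ r : ℝ → ℝ) (β p : ℝ) : ℝ :=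
  inverseOn (Ici 1) r
    (1 / (β * p) * ∫ u in (0 : ℝ)..(β * p), r (metricMassiveness B (inverseOn (Ioi 0) σ u)))

/-- The bound `Z_r(p, β, x)` for the power-type function with exponent `ζ`. -/
def tailBound (B : Type*) [MetricSpace B] (σ r : ℝ → ℝ) (ζ γ β p x : ℝ) : ℝ :=
  Real.exp ((1 - ζ) * (x * (1 - p)) ^ (ζ / (ζ - 1)) /
      (ζ * (γ ^ ζ * (1 - p) + p * β ^ ζ) ^ (1 / (ζ - 1)))) *
    entropyFactor B σ r β p

end

/-! The proof is chaining with Hölder's inequality. Let `T j` be a minimal net of radius `σ⁻¹(β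
p^(j+1))` and put a finite set `F` above `T n`. Projecting downwards writes each `X t`, `t ∈ F`, as
a value on `T 0` (standard at most `γ`) plus links whose standards are at most `β p^(j+1)`. With
Hölder weights `(1 - p) p^j` the geometric factors cancel: every link contributes `φ(β l / (1 -
p))`, these have total weight `p`, and level 0 contributes `φ(γ l / (1 - p))` with weight `1 - p`.
The weight of `F` tends to 0, so its cardinality disappears as `n → ∞` (`lintegral_iSup_exp_le`).

What remains is the weighted geometric mean of the covering numbers. By convexity of `r ∘ exp`, its
image under `r` is at most a lower Riemann sum of the entropy integral
(`prod_metricMassiveness_le_entropyFactor`).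

Chernoff's bound is then optimized in `l`; the lower bound on `x` says exactly that `φ` is evaluated
where it is a power (`exists_mul_exp_eq_tailBound`). Separability carries the bounds from a
countable set to `B`. -/

/-! ### Monotonicity of N-functions -/

namespace IsOrliczNFunction

variable {φ : ℝ → ℝ}

theorem mono_of_nonneg (hφ : IsOrliczNFunction φ) {x y : ℝ} (hx : 0 ≤ x) (hxy : x ≤ y) :
    φ x ≤ φ y := by
  rcases hx.eq_or_lt with rfl | hx
  · rcases hxy.eq_or_lt with rfl | h
    · exact le_rfl
    · rw [hφ.map_zero]
      exact (hφ.pos y h.ne').le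
  have hy : 0 < y := hx.trans_le hxy
  have h := hφ.convex.2 (mem_univ y) (mem_univ 0)
    (show (0 : ℝ) ≤ x / y by positivity)
    (show (0 : ℝ) ≤ 1 - x / y by rw [sub_nonneg, div_le_one hy]; exact hxy) (by ring)
  have hxy' : x / y ≤ 1 := (div_le_one hy).2 hxy
  have hφy := (hφ.pos y hy.ne').le
  simp only [smul_eq_mul, mul_zero, add_zero, hφ.map_zero, div_mul_cancel₀ x hy.ne'] at h
  nlinarith

theorem apply_abs (hφ : IsOrliczNFunction φ) (x : ℝ) : φ |x| = φ x := by
  rcases abs_choice x with h | h <;> rw [h]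
  exact hφ.even x

theorem mono_of_abs_le (hφ : IsOrliczNFunction φ) {x y : ℝ} (h : |x| ≤ |y|) : φ x ≤ φ y := by
  rw [← hφ.apply_abs x, ← hφ.apply_abs y]
  exact hφ.mono_of_nonneg (abs_nonneg x) h

end IsOrliczNFunction

/-! ### Exponential moments and the sub-Gaussian standard -/

section ExpMoment

variable {Ω : Type*} [MeasurableSpace Ω] {P : Measure Ω} {φ : ℝ → ℝ} {ξ η : Ω → ℝ} {a b : ℝ}

theorem ExpMomentBound.mono (hφ : IsOrliczNFunction φ) (h : ExpMomentBound φ P ξ a) (ha : 0 ≤ a)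
    (hab : a ≤ b) : ExpMomentBound φ P ξ b := fun l =>
  ⟨(h l).1, (h l).2.trans <| Real.exp_le_exp.2 <| hφ.mono_of_abs_le <| by
    rw [abs_mul, abs_mul, abs_of_nonneg ha, abs_of_nonneg (ha.trans hab)]
    gcongr⟩

theorem ExpMomentBound.neg (hφ : IsOrliczNFunction φ) (h : ExpMomentBound φ P ξ a) :
    ExpMomentBound φ P (fun ω => -ξ ω) a := fun l => by
  have h' := h (-l)
  rw [mul_neg, hφ.even] at h'
  simpa only [neg_mul, mul_neg] using h'

/-- By AM-GM, `exp (u + v) ≤ (exp (2u) + exp (2v)) / 2`. The factor 2 is harmless: the lemma only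
serves to show that standards are finite or uniformly bounded. -/
theorem ExpMomentBound.add (hξm : Measurable ξ) (hηm : Measurable η)
    (hξ : ExpMomentBound φ P ξ a) (hη : ExpMomentBound φ P η a) :
    ExpMomentBound φ P (fun ω => ξ ω + η ω) (2 * a) := fun l => by
  have hle : ∀ ω, Real.exp (l * (ξ ω + η ω)) ≤
      1 / 2 * Real.exp (2 * l * ξ ω) + 1 / 2 * Real.exp (2 * l * η ω) := fun ω => by
    have e : l * (ξ ω + η ω) = l * ξ ω + l * η ω := by ring
    have e1 : 2 * l * ξ ω = l * ξ ω + l * ξ ω := by ring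
    have e2 : 2 * l * η ω = l * η ω + l * η ω := by ring
    rw [e, e1, e2, Real.exp_add, Real.exp_add, Real.exp_add]
    nlinarith [sq_nonneg (Real.exp (l * ξ ω) - Real.exp (l * η ω))]
  have hint : Integrable (fun ω => 1 / 2 * Real.exp (2 * l * ξ ω) +
      1 / 2 * Real.exp (2 * l * η ω)) P :=
    ((hξ (2 * l)).1.const_mul _).add ((hη (2 * l)).1.const_mul _)
  have hint' : Integrable (fun ω => Real.exp (l * (ξ ω + η ω))) P :=
    hint.mono' (by fun_prop) (.of_forall fun ω => by
      rw [Real.norm_eq_abs, Real.abs_exp]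
      exact hle ω)
  refine ⟨hint', (integral_mono hint' hint hle).trans ?_⟩
  rw [integral_add ((hξ (2 * l)).1.const_mul _) ((hη (2 * l)).1.const_mul _),
    integral_const_mul, integral_const_mul]
  have h1 := (hξ (2 * l)).2
  have h2 := (hη (2 * l)).2
  have e : a * (2 * l) = 2 * a * l := by ring
  rw [e] at h1 h2
  linarith

theorem ExpMomentBound.lintegral_le (h : ExpMomentBound φ P ξ a) (l : ℝ) :
    ∫⁻ ω, ENNReal.ofReal (Real.exp (l * ξ ω)) ∂P ≤ ENNReal.ofReal (Real.exp (φ (a * l))) := by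
  rw [← ofReal_integral_eq_lintegral_ofReal (h l).1 (.of_forall fun ω => (Real.exp_pos _).le)]
  exact ENNReal.ofReal_le_ofReal (h l).2

theorem subGaussianStandard_nonneg : 0 ≤ subGaussianStandard φ P ξ :=
  Real.sInf_nonneg fun _ ha => ha.1

theorem subGaussianStandard_le (ha : 0 ≤ a) (h : ExpMomentBound φ P ξ a) :
    subGaussianStandard φ P ξ ≤ a :=
  csInf_le ⟨0, fun _ hb => hb.1⟩ ⟨ha, h⟩

/-- The infimum in the definition of the `φ`-sub-Gaussian standard is attained. -/
theorem expMomentBound_subGaussianStandard (hφ : IsOrliczNFunction φ)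
    (h : ∃ a : ℝ, 0 ≤ a ∧ ExpMomentBound φ P ξ a) :
    ExpMomentBound φ P ξ (subGaussianStandard φ P ξ) := by
  have hmem := csInf_mem_closure (s := {a : ℝ | 0 ≤ a ∧ ExpMomentBound φ P ξ a}) h
    ⟨0, fun _ hb => hb.1⟩
  obtain ⟨a, -, ha⟩ := h
  refine fun l => ⟨(ha l).1, ?_⟩
  -- For fixed `l` the integral does not involve `b`, so continuity of `φ` makes the condition
  -- closed and it passes to the infimum.
  have hclosed : IsClosed {b : ℝ | ∫ ω, Real.exp (l * ξ ω) ∂P ≤ Real.exp (φ (b * l))} :=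
    isClosed_le continuous_const
      (Real.continuous_exp.comp (hφ.continuous.comp (continuous_id.mul continuous_const)))
  exact closure_minimal (fun b hb => (hb.2 l).2) hclosed hmem

end ExpMoment

/-! ### Chaining and Hölder's inequality -/

section Chaining

variable {Ω B : Type*}

/-- The increment of `Y` at `s` along the link from level `j` to the level below it. -/
def chainLink (Y : B → Ω → ℝ) (π : ℕ → B → B) : ℕ → B → Ω → ℝ
  | 0, s, ω => Y s ω
  | j + 1, s, ω => Y s ω - Y (π j s) ω

theorem measurable_chainLink [MeasurableSpace Ω] {Y : B → Ω → ℝ} (hY : ∀ t, Measurable (Y t)) (π : ℕ → B → B)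
    (j : ℕ) (s : B) : Measurable (chainLink Y π j s) := by
  cases j with
  | zero => exact hY s
  | succ j => exact (hY s).sub (hY (π j s))

/-- The exponential of a telescoping sum is a product over the links. Each factor is a `w j`-th
power of one term of a nonnegative sum over `T j`, and the whole sum no longer depends on `t`. -/
theorem ofReal_exp_le_prod_sum_chainLink (Y : B → Ω → ℝ) (π : ℕ → B → B) (T : ℕ → Finset B)
    (w : ℕ → ℝ) (l : ℝ) (ω : Ω) (n : ℕ) (hw : ∀ j ≤ n, 0 < w j)
    (hπ : ∀ j < n, ∀ s ∈ T (j + 1), π j s ∈ T j) :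
    ∀ t ∈ T n, ENNReal.ofReal (Real.exp (l * Y t ω)) ≤ ∏ j ∈ Finset.range (n + 1),
      (∑ s ∈ T j, ENNReal.ofReal (Real.exp (l / w j * chainLink Y π j s ω))) ^ w j := by
  have key : ∀ j ≤ n, ∀ s ∈ T j, ENNReal.ofReal (Real.exp (l * chainLink Y π j s ω)) ≤
      (∑ s ∈ T j, ENNReal.ofReal (Real.exp (l / w j * chainLink Y π j s ω))) ^ w j := by
    intro j hj s hs
    have hwj := hw j hj
    calc ENNReal.ofReal (Real.exp (l * chainLink Y π j s ω))
        = ENNReal.ofReal (Real.exp (l / w j * chainLink Y π j s ω)) ^ w j := by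
          rw [ENNReal.ofReal_rpow_of_pos (Real.exp_pos _), ← Real.exp_mul]
          congr 2
          field_simp
      _ ≤ _ := by
          refine ENNReal.rpow_le_rpow ?_ hwj.le
          exact Finset.single_le_sum
            (f := fun s => ENNReal.ofReal (Real.exp (l / w j * chainLink Y π j s ω)))
            (fun _ _ => zero_le) hs
  induction n with
  | zero =>
    intro t ht
    rw [zero_add, Finset.prod_range_one]
    exact key 0 le_rfl t ht
  | succ n ih =>
    intro t ht
    rw [Finset.prod_range_succ]
    have e : l * Y t ω = l * Y (π n t) ω + l * chainLink Y π (n + 1) t ω := by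
      simp only [chainLink]
      ring
    rw [e, Real.exp_add, ENNReal.ofReal_mul (Real.exp_pos _).le]
    exact mul_le_mul' (ih (fun j hj => hw j (by omega)) (fun j hj => hπ j (by omega))
      (fun j hj => key j (by omega)) _ (hπ n (Nat.lt_succ_self n) t ht)) (key _ le_rfl t ht)

/-- Chaining: the exponential moment of the maximum over the top level is controlled by the
exponential moments of the links, by Hölder's inequality with exponents `1 / w j`. -/
theorem lintegral_iSup_exp_le_prod [MeasurableSpace Ω] {P : Measure Ω} {Y : B → Ω → ℝ}
    (hY : ∀ t, Measurable (Y t)) (π : ℕ → B → B)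
    (T : ℕ → Finset B) (w : ℕ → ℝ) (l : ℝ) (n : ℕ) (hw : ∀ j ≤ n, 0 < w j)
    (hw1 : ∑ j ∈ Finset.range (n + 1), w j = 1)
    (hπ : ∀ j < n, ∀ s ∈ T (j + 1), π j s ∈ T j) (e : ℕ → ENNReal)
    (he : ∀ j ≤ n, ∀ s ∈ T j,
      ∫⁻ ω, ENNReal.ofReal (Real.exp (l / w j * chainLink Y π j s ω)) ∂P ≤ e j) :
    ∫⁻ ω, ⨆ t ∈ T n, ENNReal.ofReal (Real.exp (l * Y t ω)) ∂P ≤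
      ∏ j ∈ Finset.range (n + 1), ((T j).card * e j) ^ w j := by
  have hm : ∀ j s, Measurable
      (fun ω => ENNReal.ofReal (Real.exp (l / w j * chainLink Y π j s ω))) := fun j s =>
    ((measurable_chainLink hY π j s).const_mul _).exp.ennreal_ofReal
  calc ∫⁻ ω, ⨆ t ∈ T n, ENNReal.ofReal (Real.exp (l * Y t ω)) ∂P
      ≤ ∫⁻ ω, ∏ j ∈ Finset.range (n + 1),
          (∑ s ∈ T j, ENNReal.ofReal (Real.exp (l / w j * chainLink Y π j s ω))) ^ w j ∂P :=
        lintegral_mono fun ω => iSup₂_le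
          (ofReal_exp_le_prod_sum_chainLink Y π T w l ω n hw hπ)
    _ ≤ ∏ j ∈ Finset.range (n + 1), (∫⁻ ω,
          ∑ s ∈ T j, ENNReal.ofReal (Real.exp (l / w j * chainLink Y π j s ω)) ∂P) ^ w j :=
        ENNReal.lintegral_prod_norm_pow_le _
          (fun j _ => (Finset.measurable_sum _ fun s _ => hm j s).aemeasurable) hw1
          (fun j hj => (hw j (Nat.lt_succ_iff.1 (Finset.mem_range.1 hj))).le)
    _ ≤ _ := by
        refine Finset.prod_le_prod' fun j hj => ?_
        have hjn := Nat.lt_succ_iff.1 (Finset.mem_range.1 hj)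
        refine ENNReal.rpow_le_rpow ?_ (hw j hjn).le
        rw [lintegral_finsetSum _ fun s _ => hm j s]
        refine (Finset.sum_le_sum (he j hjn)).trans ?_
        rw [Finset.sum_const, nsmul_eq_mul]

end Chaining

/-! ### The inverse of the modulus -/

section InverseModulus

variable {σ : ℝ → ℝ} {R u v : ℝ}

theorem exists_pos_apply_le (hσ0 : Tendsto σ (𝓝[>] 0) (𝓝 0)) (hu : 0 < u) :
    {h | h ∈ Ioi (0 : ℝ) ∧ σ h ≤ u}.Nonempty := by
  have h1 : ∀ᶠ h in 𝓝[>] (0 : ℝ), σ h < u := hσ0.eventually_lt_const hu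
  obtain ⟨k, h1, h2⟩ := (h1.and self_mem_nhdsWithin).exists
  exact ⟨k, h2, h1.le⟩

theorem nonneg_of_monotoneOn_of_tendsto (hσm : MonotoneOn σ (Ioi 0))
    (hσ0 : Tendsto σ (𝓝[>] 0) (𝓝 0)) (hR : 0 < R) : 0 ≤ σ R := by
  refine le_of_tendsto hσ0 ?_
  filter_upwards [Ioo_mem_nhdsGT hR] with x hx using hσm hx.1 hR hx.2.le

/-- Strictness of `u < σ R` matters: for larger `u` the set may be unbounded, and `sSup` then takes
its default value 0. -/
theorem bddAbove_apply_le (hσm : MonotoneOn σ (Ioi 0)) (hR : 0 < R) (hu : u < σ R) :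
    BddAbove {h | h ∈ Ioi (0 : ℝ) ∧ σ h ≤ u} :=
  ⟨R, fun _ hh => le_of_not_gt fun hlt =>
    (hu.trans_le (hσm hR hh.1 hlt.le)).not_ge hh.2⟩

theorem inverseOn_Ioi_pos (hσ0 : Tendsto σ (𝓝[>] 0) (𝓝 0)) (hσm : MonotoneOn σ (Ioi 0))
    (hR : 0 < R) (hu0 : 0 < u) (hu : u < σ R) : 0 < inverseOn (Ioi 0) σ u := by
  obtain ⟨h, hh⟩ := exists_pos_apply_le hσ0 hu0
  exact lt_of_lt_of_le hh.1 (le_csSup (bddAbove_apply_le hσm hR hu) hh)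

theorem apply_inverseOn_Ioi_le (hσc : ContinuousOn σ (Ioi 0)) (hσ0 : Tendsto σ (𝓝[>] 0) (𝓝 0))
    (hσm : MonotoneOn σ (Ioi 0)) (hR : 0 < R) (hu0 : 0 < u) (hu : u < σ R) :
    σ (inverseOn (Ioi 0) σ u) ≤ u := by
  have hcl := csSup_mem_closure (exists_pos_apply_le hσ0 hu0) (bddAbove_apply_le hσm hR hu)
  exact ContinuousWithinAt.closure_le hcl
    ((hσc _ (inverseOn_Ioi_pos hσ0 hσm hR hu0 hu)).mono fun h hh => hh.1)
    continuousWithinAt_const fun h hh => hh.2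

theorem inverseOn_Ioi_mono (hσ0 : Tendsto σ (𝓝[>] 0) (𝓝 0)) (hσm : MonotoneOn σ (Ioi 0))
    (hR : 0 < R) (hu0 : 0 < u) (huv : u ≤ v) (hv : v < σ R) :
    inverseOn (Ioi 0) σ u ≤ inverseOn (Ioi 0) σ v :=
  csSup_le_csSup (bddAbove_apply_le hσm hR hv) (exists_pos_apply_le hσ0 hu0)
    fun _ hh => ⟨hh.1, hh.2.trans huv⟩

end InverseModulus

/-! ### Covering numbers of a compact space -/

section Massiveness

variable {B : Type*} [MetricSpace B] [CompactSpace B]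

/-- Needed because `toNat` sends `⊤` to 0. -/
theorem coveringNumber_univ_ne_top {u : ℝ} (hu : 0 < u) :
    Metric.coveringNumber u.toNNReal (univ : Set B) ≠ ⊤ := by
  obtain ⟨C, -, hfin, hC⟩ := (isCompact_univ (X := B)).finite_cover_balls hu
  have hcover : Metric.IsCover u.toNNReal (univ : Set B) C := fun x hx => by
    obtain ⟨y, hy, hxy⟩ := mem_iUnion₂.1 (hC hx)
    refine ⟨y, hy, ?_⟩
    change edist x y ≤ u.toNNReal
    rw [edist_dist]
    exact ENNReal.ofReal_le_ofReal (Metric.mem_ball.1 hxy).le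
  exact ((hcover.coveringNumber_le_encard (subset_univ C)).trans_lt
    (encard_lt_top_iff.2 hfin)).ne

theorem exists_net_card_eq_metricMassiveness {u : ℝ} (hu : 0 < u) :
    ∃ T : Finset B, T.card = metricMassiveness B u ∧ ∀ t, ∃ s ∈ T, dist t s ≤ u := by
  obtain ⟨C, -, hfin, hC, hcard⟩ :=
    Metric.exists_set_encard_eq_coveringNumber (coveringNumber_univ_ne_top (B := B) hu)
  refine ⟨hfin.toFinset, ?_, fun t => ?_⟩
  · rw [metricMassiveness, ← hcard, hfin.encard_eq_coe_toFinset_card]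
    rfl
  · obtain ⟨s, hs, hts⟩ := hC (mem_univ t)
    refine ⟨s, hfin.mem_toFinset.2 hs, ?_⟩
    change edist t s ≤ u.toNNReal at hts
    rw [edist_dist] at hts
    exact (ENNReal.ofReal_le_ofReal_iff hu.le).1 hts

theorem one_le_metricMassiveness [Nonempty B] {u : ℝ} (hu : 0 < u) :
    1 ≤ metricMassiveness B u := by
  obtain ⟨T, hT, hcov⟩ := exists_net_card_eq_metricMassiveness (B := B) hu
  obtain ⟨s, hs, -⟩ := hcov (Classical.arbitrary B)
  rw [← hT]
  exact Finset.card_pos.2 ⟨s, hs⟩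

theorem metricMassiveness_anti {u v : ℝ} (hu : 0 < u) (huv : u ≤ v) :
    metricMassiveness B v ≤ metricMassiveness B u :=
  ENat.toNat_le_toNat (Metric.coveringNumber_anti (Real.toNNReal_le_toNNReal huv))
    (coveringNumber_univ_ne_top hu)

/-- By the triangle inequality every point is at distance at least `dist a b / 2` from `a` or from
`b`. -/
theorem radius_pos [Nontrivial B] : 0 < ⨅ s : B, ⨆ t : B, dist t s := by
  obtain ⟨a, b, hab⟩ := exists_pair_ne B
  have hpos : 0 < dist a b := dist_pos.2 hab
  refine lt_of_lt_of_le (half_pos hpos) (le_ciInf fun s => ?_)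
  have hbdd : BddAbove (range fun t : B => dist t s) :=
    (isCompact_range (continuous_id.dist continuous_const)).bddAbove
  have h1 := le_ciSup hbdd a
  have h2 := le_ciSup hbdd b
  have h3 := dist_triangle_right a b s
  linarith

end Massiveness

/-! ### Jensen's inequality and geometric Riemann sums -/

section Entropy

variable {r : ℝ → ℝ}

/-- Past `t = 2` the convex function `r (exp t)` stays above the line of slope `d > 0` through its
values at 1 and 2, so it exceeds `y` eventually. This makes the supremum defining the inverse of `r`
a genuine one. -/
theorem bddAbove_le_of_convexOn_exp (hrm : StrictMonoOn r (Ici 1))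
    (hrconv : ConvexOn ℝ (Ioi 0) (fun t => r (Real.exp t))) (y : ℝ) :
    BddAbove {h | h ∈ Ici (1 : ℝ) ∧ r h ≤ y} := by
  have hlt : r (Real.exp 1) < r (Real.exp 2) :=
    hrm (Real.one_le_exp (by norm_num)) (Real.one_le_exp (by norm_num))
      (Real.exp_lt_exp.2 (by norm_num))
  set d := r (Real.exp 2) - r (Real.exp 1) with hd
  have hd0 : 0 < d := sub_pos.2 hlt
  refine ⟨Real.exp (max 2 (2 + (y - r (Real.exp 2)) / d)), fun h hh => ?_⟩
  have hh0 : 0 < h := lt_of_lt_of_le one_pos hh.1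
  by_contra! hlt'
  rw [← Real.exp_log hh0, Real.exp_lt_exp, max_lt_iff] at hlt'
  have hslope := hrconv.slope_mono_adjacent (x := 1) (y := 2) (z := Real.log h)
    (mem_Ioi.2 one_pos) (mem_Ioi.2 (by linarith)) (by norm_num) hlt'.1
  rw [Real.exp_log hh0, ← hd, le_div_iff₀ (by linarith)] at hslope
  have h2 := hlt'.2
  rw [← lt_sub_iff_add_lt', div_lt_iff₀ hd0] at h2
  have := hh.2
  norm_num at hslope
  nlinarith

theorem le_inverseOn_Ici (hrm : StrictMonoOn r (Ici 1))
    (hrconv : ConvexOn ℝ (Ioi 0) (fun t => r (Real.exp t))) {h y : ℝ} (hh : 1 ≤ h)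
    (hy : r h ≤ y) : h ≤ inverseOn (Ici 1) r y :=
  le_csSup (bddAbove_le_of_convexOn_exp hrm hrconv y) ⟨hh, hy⟩

/-- Jensen's inequality for weighted geometric means. -/
theorem apply_prod_rpow_le_sum (hrc : ContinuousOn r (Ici 1))
    (hrconv : ConvexOn ℝ (Ioi 0) (fun t => r (Real.exp t))) {ι : Type*} (s : Finset ι)
    (w N : ι → ℝ) (hw : ∀ i ∈ s, 0 ≤ w i) (hw1 : ∑ i ∈ s, w i = 1) (hN : ∀ i ∈ s, 1 ≤ N i) :
    r (∏ i ∈ s, N i ^ w i) ≤ ∑ i ∈ s, w i * r (N i) := by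
  -- Convexity is available only on the open half-line, while `log (N i)` may be 0. All logarithms
  -- are shifted by `δ > 0`, and `δ → 0` at the end.
  have hcont : ∀ a : ℝ, 0 ≤ a →
      Tendsto (fun δ : ℝ => r (Real.exp (a + δ))) (𝓝[>] 0) (𝓝 (r (Real.exp a))) := by
    intro a ha
    refine (hrc _ (Real.one_le_exp ha)).tendsto.comp (tendsto_nhdsWithin_iff.2 ⟨?_, ?_⟩)
    · have : Continuous fun δ : ℝ => Real.exp (a + δ) := by fun_prop
      simpa using (this.tendsto 0).mono_left nhdsWithin_le_nhds
    · exact eventually_nhdsWithin_of_forall fun δ hδ =>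
        Real.one_le_exp (add_nonneg ha (le_of_lt hδ))
  have hlog : ∀ i ∈ s, 0 ≤ Real.log (N i) := fun i hi => Real.log_nonneg (hN i hi)
  have hpos : ∀ i ∈ s, 0 < N i := fun i hi => one_pos.trans_le (hN i hi)
  have hprod : ∏ i ∈ s, N i ^ w i = Real.exp (∑ i ∈ s, w i * Real.log (N i)) := by
    rw [Real.exp_sum]
    refine Finset.prod_congr rfl fun i hi => ?_
    rw [Real.rpow_def_of_pos (hpos i hi), mul_comm]
  have hsum : 0 ≤ ∑ i ∈ s, w i * Real.log (N i) :=
    Finset.sum_nonneg fun i hi => mul_nonneg (hw i hi) (hlog i hi)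
  rw [hprod]
  have hR : Tendsto (fun δ : ℝ => ∑ i ∈ s, w i * r (Real.exp (Real.log (N i) + δ))) (𝓝[>] 0)
      (𝓝 (∑ i ∈ s, w i * r (N i))) := by
    refine tendsto_finsetSum _ fun i hi => ?_
    have := (hcont _ (hlog i hi)).const_mul (w i)
    rwa [Real.exp_log (hpos i hi)] at this
  refine le_of_tendsto_of_tendsto (hcont _ hsum) hR
    (eventually_nhdsWithin_of_forall fun δ hδ => ?_)
  have hJ := hrconv.map_sum_le (t := s) (w := w) (p := fun i => Real.log (N i) + δ) hw hw1
    fun i hi => mem_Ioi.2 (add_pos_of_nonneg_of_pos (hlog i hi) hδ)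
  simp only [smul_eq_mul, mul_add, Finset.sum_add_distrib, ← Finset.sum_mul, hw1, one_mul] at hJ
  exact hJ

/-- A geometric lower Riemann sum of an antitone function is at most its integral. -/
theorem geometric_sum_le_integral {f : ℝ → ℝ} {p c : ℝ} (hp0 : 0 < p) (hp1 : p < 1) (n : ℕ) :
    ∀ {b : ℝ}, 0 < b → IntervalIntegrable f volume 0 b → AntitoneOn f (Ioc 0 b) →
      (∀ u ∈ Ioc 0 b, c ≤ f u) →
      b * (∑ j ∈ Finset.range n, (1 - p) * p ^ j * f (b * p ^ j) + p ^ n * c) ≤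
        ∫ u in (0 : ℝ)..b, f u := by
  induction n with
  | zero =>
    intro b hb hf _ hc
    have := intervalIntegral.integral_mono_on_of_le_Ioo hb.le intervalIntegrable_const hf
      fun u hu => hc u ⟨hu.1, hu.2.le⟩
    simpa using this
  | succ n ih =>
    intro b hb hf hanti hc
    have hbp : 0 < b * p := mul_pos hb hp0
    have hbp' : b * p ≤ b := by nlinarith
    have hf1 : IntervalIntegrable f volume 0 (b * p) :=
      hf.mono_set (by rw [uIcc_of_le hbp.le, uIcc_of_le hb.le]; exact Icc_subset_Icc_right hbp')
    have hf2 : IntervalIntegrable f volume (b * p) b :=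
      hf.mono_set (by rw [uIcc_of_le hbp', uIcc_of_le hb.le]; exact Icc_subset_Icc_left hbp.le)
    have hsub : Ioc 0 (b * p) ⊆ Ioc 0 b := Ioc_subset_Ioc_right hbp'
    -- Self-similarity: on `(b p, b]`, of length `b (1 - p)`, the integrand is at least `f b`; the
    -- rest is the same statement for `b p`.
    have h1 := ih hbp hf1 (hanti.mono hsub) fun u hu => hc u (hsub hu)
    have h2 := intervalIntegral.integral_mono_on_of_le_Ioo hbp'
      (intervalIntegrable_const (c := f b)) hf2
      fun u hu => hanti ⟨hbp.trans hu.1, hu.2.le⟩ ⟨hb, le_rfl⟩ hu.2.le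
    rw [intervalIntegral.integral_const, smul_eq_mul] at h2
    rw [← intervalIntegral.integral_add_adjacent_intervals hf1 hf2, Finset.sum_range_succ']
    refine le_trans (le_of_eq ?_) (add_le_add h1 h2)
    have e : ∑ j ∈ Finset.range n, (1 - p) * p ^ (j + 1) * f (b * p ^ (j + 1)) =
        p * ∑ j ∈ Finset.range n, (1 - p) * p ^ j * f (b * p * p ^ j) := by
      rw [Finset.mul_sum]
      refine Finset.sum_congr rfl fun j _ => ?_
      rw [show b * p * p ^ j = b * p ^ (j + 1) by ring]
      ring
    rw [e]
    simp only [pow_zero, mul_one]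
    ring

end Entropy

/-! ### Hölder weights -/

section ChainWeight

/-- The Hölder weights `(1 - p) p ^ j`, `j < n`, completed to total mass one at level `n`. -/
noncomputable def chainWeight (p : ℝ) (n j : ℕ) : ℝ :=
  if j < n then (1 - p) * p ^ j else p ^ n

variable {p : ℝ} {n j : ℕ}

theorem chainWeight_of_lt (h : j < n) : chainWeight p n j = (1 - p) * p ^ j := if_pos h

theorem chainWeight_self : chainWeight p n n = p ^ n := if_neg (lt_irrefl n)

theorem chainWeight_pos (hp0 : 0 < p) (hp1 : p < 1) : 0 < chainWeight p n j := by
  have := sub_pos.2 hp1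
  unfold chainWeight
  split_ifs <;> positivity

/-- The top weight `p ^ n` is only larger than the geometric pattern, so the link bound holds there
too. -/
theorem le_chainWeight (hp0 : 0 < p) (hj : j ≤ n) :
    (1 - p) * p ^ j ≤ chainWeight p n j := by
  rcases hj.lt_or_eq with h | rfl
  · rw [chainWeight_of_lt h]
  · rw [chainWeight_self]
    nlinarith [pow_pos hp0 j]

theorem sum_chainWeight_mul (f : ℕ → ℝ) :
    ∑ j ∈ Finset.range (n + 1), chainWeight p n j * f j =
      ∑ j ∈ Finset.range n, (1 - p) * p ^ j * f j + p ^ n * f n := by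
  rw [Finset.sum_range_succ, chainWeight_self]
  congr 1
  exact Finset.sum_congr rfl fun j hj => by rw [chainWeight_of_lt (Finset.mem_range.1 hj)]

theorem sum_chainWeight : ∑ j ∈ Finset.range (n + 1), chainWeight p n j = 1 := by
  have h := sum_chainWeight_mul (p := p) (n := n) fun _ => 1
  simp only [mul_one] at h
  rw [h, ← Finset.mul_sum, mul_neg_geom_sum]
  ring

end ChainWeight

/-! ### From covering numbers to the entropy integral -/

section EntropyFactor

variable {B : Type*} [MetricSpace B] [CompactSpace B] [Nonempty B] {σ r : ℝ → ℝ} {R p : ℝ}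

/-- Jensen bounds `r` of the product by a weighted sum; the weights `(1 - p) p^j` are the relative
lengths of the intervals of a geometric partition of `(0, β p]`, with `β = σ R`, and the values are
taken at right endpoints, where the integrand is least. -/
theorem prod_metricMassiveness_le_entropyFactor
    (hσm : MonotoneOn σ (Ioi 0)) (hσ0 : Tendsto σ (𝓝[>] 0) (𝓝 0)) (hR : 0 < R) (hβ0 : 0 < σ R)
    (hrc : ContinuousOn r (Ici 1)) (hrm : StrictMonoOn r (Ici 1))
    (hrconv : ConvexOn ℝ (Ioi 0) (fun t => r (Real.exp t)))
    (hent : IntervalIntegrable (fun u => r (metricMassiveness B (inverseOn (Ioi 0) σ u)))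
      volume 0 (σ R)) (hp0 : 0 < p) (hp1 : p < 1) (n : ℕ) :
    ∏ j ∈ Finset.range n,
        (metricMassiveness B (inverseOn (Ioi 0) σ (σ R * p ^ (j + 1))) : ℝ) ^ ((1 - p) * p ^ j) ≤
      entropyFactor B σ r (σ R) p := by
  set f : ℝ → ℝ := fun u => r (metricMassiveness B (inverseOn (Ioi 0) σ u)) with hf
  have hb : 0 < σ R * p := mul_pos hβ0 hp0
  have hbβ : σ R * p < σ R := by nlinarith
  have hN : ∀ u ∈ Ioc 0 (σ R * p),
      1 ≤ (metricMassiveness B (inverseOn (Ioi 0) σ u) : ℝ) := fun u hu => by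
    exact_mod_cast one_le_metricMassiveness
      (inverseOn_Ioi_pos hσ0 hσm hR hu.1 (hu.2.trans_lt hbβ))
  have hanti : AntitoneOn f (Ioc 0 (σ R * p)) := fun u hu v hv huv =>
    hrm.monotoneOn (hN v hv) (hN u hu) <| by
      exact_mod_cast metricMassiveness_anti
        (inverseOn_Ioi_pos hσ0 hσm hR hu.1 (hu.2.trans_lt hbβ))
        (inverseOn_Ioi_mono hσ0 hσm hR hu.1 huv (hv.2.trans_lt hbβ))
  have hint : IntervalIntegrable f volume 0 (σ R * p) :=
    hent.mono_set (by
      rw [uIcc_of_le hb.le, uIcc_of_le hβ0.le]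
      exact Icc_subset_Icc_right hbβ.le)
  have hgeom := geometric_sum_le_integral (c := r 1) hp0 hp1 n hb hint hanti fun u hu =>
    hrm.monotoneOn (mem_Ici.2 le_rfl) (hN u hu) (hN u hu)
  have hmem : ∀ j : ℕ, σ R * p ^ (j + 1) ∈ Ioc 0 (σ R * p) := fun j => by
    refine ⟨by positivity, ?_⟩
    have : p ^ (j + 1) ≤ p := by
      simpa using pow_le_pow_of_le_one hp0.le hp1.le (Nat.le_add_left 1 j)
    gcongr
  -- The leftover mass `p ^ n` is given the value 1, which leaves the product unchanged and matches
  -- the constant `c = r 1` used near 0.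
  set N : ℕ → ℝ := fun j =>
    if j < n then (metricMassiveness B (inverseOn (Ioi 0) σ (σ R * p ^ (j + 1))) : ℝ) else 1
    with hNdef
  have hN1 : ∀ j, 1 ≤ N j := fun j => by
    simp only [hNdef]
    split_ifs
    · exact hN _ (hmem j)
    · exact le_rfl
  have hJ := apply_prod_rpow_le_sum hrc hrconv (Finset.range (n + 1)) (chainWeight p n) N
    (fun j _ => (chainWeight_pos hp0 hp1).le) sum_chainWeight (fun j _ => hN1 j)
  have hNn : N n = 1 := if_neg (lt_irrefl n)
  have hNj : ∀ j ∈ Finset.range n,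
      N j = metricMassiveness B (inverseOn (Ioi 0) σ (σ R * p ^ (j + 1))) := fun j hj =>
    if_pos (Finset.mem_range.1 hj)
  have hprod : ∏ j ∈ Finset.range (n + 1), N j ^ chainWeight p n j = ∏ j ∈ Finset.range n,
        (metricMassiveness B (inverseOn (Ioi 0) σ (σ R * p ^ (j + 1))) : ℝ) ^
          ((1 - p) * p ^ j) := by
    rw [Finset.prod_range_succ, hNn, Real.one_rpow, mul_one]
    exact Finset.prod_congr rfl fun j hj => by
      rw [hNj j hj, chainWeight_of_lt (Finset.mem_range.1 hj)]
  rw [sum_chainWeight_mul, hNn, hprod] at hJ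
  refine le_inverseOn_Ici hrm hrconv ?_ (hJ.trans ?_)
  · rw [← hprod]
    exact Finset.prod_induction _ (1 ≤ ·) (fun _ _ => one_le_mul_of_one_le_of_one_le) le_rfl
      fun j _ => Real.one_le_rpow (hN1 j) (chainWeight_pos hp0 hp1).le
  · rw [one_div, ← div_eq_inv_mul, le_div_iff₀ hb, mul_comm]
    refine le_trans (le_of_eq ?_) hgeom
    congr 2
    refine Finset.sum_congr rfl fun j hj => ?_
    rw [hNj j hj, hf, show σ R * p * p ^ j = σ R * p ^ (j + 1) by ring]

end EntropyFactor

/-! ### The exponential moment of a finite maximum -/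

section ExponentialMoment

variable {Ω B : Type*} [MeasurableSpace Ω] {P : Measure Ω} {φ : ℝ → ℝ}

/-- The exponential moment of a maximum over a finite set, by chaining along nets `T j` whose links
have geometrically decreasing `φ`-sub-Gaussian standards. -/
theorem lintegral_iSup_exp_le_of_chain (hφ : IsOrliczNFunction φ) {Y : B → Ω → ℝ}
    (hY : ∀ t, Measurable (Y t)) {γ β p l : ℝ} (hβ : 0 ≤ β) (hp0 : 0 < p)
    (hp1 : p < 1) (hl : 0 ≤ l) (hY0 : ∀ t, ExpMomentBound φ P (Y t) γ) (T : ℕ → Finset B)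
    (π : ℕ → B → B) (hπT : ∀ j s, π j s ∈ T j)
    (hπ : ∀ j s, ExpMomentBound φ P (fun ω => Y s ω - Y (π j s) ω) (β * p ^ (j + 1)))
    (F : Finset B) (n : ℕ) :
    ∫⁻ ω, ⨆ t ∈ F, ENNReal.ofReal (Real.exp (l * Y t ω)) ∂P ≤
      ENNReal.ofReal ((∏ j ∈ Finset.range (n + 1), ((T j).card : ℝ) ^ ((1 - p) * p ^ j)) *
        (F.card : ℝ) ^ p ^ (n + 1) *
        Real.exp ((1 - p) * φ (γ * (l / (1 - p))) + p * φ (β * (l / (1 - p))))) := by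
  have hq : 0 < 1 - p := sub_pos.2 hp1
  set w := chainWeight p (n + 1) with hw
  set U : ℕ → Finset B := fun j => if j < n + 1 then T j else F with hU
  -- The exponent is the same at all levels except 0, where `γ` replaces `β`.
  set a : ℕ → ℝ := fun j => φ (β * (l / (1 - p))) +
    if j = 0 then φ (γ * (l / (1 - p))) - φ (β * (l / (1 - p))) else 0 with ha
  have hwpos : ∀ j, 0 < w j := fun j => chainWeight_pos hp0 hp1
  have hw0 : w 0 = 1 - p := by
    rw [hw, chainWeight_of_lt (Nat.succ_pos n), pow_zero, mul_one]
  have hUlt : ∀ j < n + 1, U j = T j := fun j hj => if_pos hj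
  have hUn : U (n + 1) = F := if_neg (lt_irrefl _)
  have hlink : ∀ j ≤ n + 1, ∀ s ∈ U j,
      ∫⁻ ω, ENNReal.ofReal (Real.exp (l / w j * chainLink Y π j s ω)) ∂P ≤
        ENNReal.ofReal (Real.exp (a j)) := by
    intro j hj s _
    cases j with
    | zero =>
      have h := (hY0 s).lintegral_le (l / w 0)
      have e : a 0 = φ (γ * (l / w 0)) := by simp [ha, hw0]
      rw [e]
      exact h
    | succ j =>
      refine ((hπ j s).lintegral_le (l / w (j + 1))).trans
        (ENNReal.ofReal_le_ofReal (Real.exp_le_exp.2 ?_))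
      have e : a (j + 1) = φ (β * (l / (1 - p))) := by simp [ha]
      rw [e]
      have hwj := hwpos (j + 1)
      refine hφ.mono_of_nonneg (by positivity) ?_
      calc β * p ^ (j + 1) * (l / w (j + 1))
          ≤ β * p ^ (j + 1) * (l / ((1 - p) * p ^ (j + 1))) := by
            gcongr
            exact le_chainWeight hp0 hj
        _ = β * (l / (1 - p)) := by field_simp
  have h := lintegral_iSup_exp_le_prod (P := P) hY π U w l (n + 1) (fun j _ => hwpos j)
    sum_chainWeight (fun j hj s _ => by rw [hUlt j hj]; exact hπT j s)
    (fun j => ENNReal.ofReal (Real.exp (a j))) hlink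
  rw [hUn] at h
  refine h.trans (le_of_eq ?_)
  have hterm : ∀ j, ((U j).card * ENNReal.ofReal (Real.exp (a j))) ^ w j =
      ENNReal.ofReal (((U j).card : ℝ) ^ w j * Real.exp (w j * a j)) := fun j => by
    rw [← ENNReal.ofReal_natCast, ← ENNReal.ofReal_mul (Nat.cast_nonneg _),
      ENNReal.ofReal_rpow_of_nonneg (by positivity) (hwpos j).le,
      Real.mul_rpow (Nat.cast_nonneg _) (Real.exp_pos _).le, ← Real.exp_mul, mul_comm (a j)]
  rw [Finset.prod_congr rfl fun j _ => hterm j,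
    ← ENNReal.ofReal_prod_of_nonneg fun j _ => by positivity, Finset.prod_mul_distrib,
    ← Real.exp_sum, Finset.prod_range_succ, hUn, hw, chainWeight_self, ← hw]
  have hsum : ∑ j ∈ Finset.range (n + 1 + 1), w j * a j =
      (1 - p) * φ (γ * (l / (1 - p))) + p * φ (β * (l / (1 - p))) := by
    simp only [ha, mul_add, Finset.sum_add_distrib, ← Finset.sum_mul, hw, sum_chainWeight]
    rw [Finset.sum_range_succ']
    simp only [Nat.add_eq_zero_iff, one_ne_zero, and_false, if_false, mul_zero,
      Finset.sum_const_zero, if_true]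
    rw [← hw, hw0]
    ring
  rw [hsum]
  congr 3
  exact Finset.prod_congr rfl fun j hj => by
    rw [hUlt j (Finset.mem_range.1 hj), hw, chainWeight_of_lt (Finset.mem_range.1 hj)]

/-- The exponential moment of a maximum over a finite set, in terms of the entropy integral. -/
theorem lintegral_iSup_exp_le [MetricSpace B] [CompactSpace B] [Nonempty B]
    (hφ : IsOrliczNFunction φ) {Y : B → Ω → ℝ} (hY : ∀ t, Measurable (Y t))
    {γ p l R : ℝ} {σ r : ℝ → ℝ} (hp0 : 0 < p) (hp1 : p < 1) (hl : 0 ≤ l)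
    (hY0 : ∀ t, ExpMomentBound φ P (Y t) γ)
    (hσc : ContinuousOn σ (Ioi 0)) (hσm : MonotoneOn σ (Ioi 0))
    (hσ0 : Tendsto σ (𝓝[>] 0) (𝓝 0)) (hR : 0 < R) (hβ0 : 0 < σ R)
    (hσY : ∀ h : ℝ, 0 < h → ∀ s t : B, dist t s ≤ h →
      ExpMomentBound φ P (fun ω => Y t ω - Y s ω) (σ h))
    (hrc : ContinuousOn r (Ici 1)) (hrm : StrictMonoOn r (Ici 1))
    (hrconv : ConvexOn ℝ (Ioi 0) (fun t => r (Real.exp t)))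
    (hent : IntervalIntegrable (fun u => r (metricMassiveness B (inverseOn (Ioi 0) σ u)))
      volume 0 (σ R)) (F : Finset B) :
    ∫⁻ ω, ⨆ t ∈ F, ENNReal.ofReal (Real.exp (l * Y t ω)) ∂P ≤
      ENNReal.ofReal (entropyFactor B σ r (σ R) p *
        Real.exp ((1 - p) * φ (γ * (l / (1 - p))) + p * φ (σ R * (l / (1 - p))))) := by
  rcases F.eq_empty_or_nonempty with rfl | hF
  · simp
  -- Levels start at `β p` rather than `β`, so the inverse of `σ` is used only strictly below `σ R`.
  have hlt : ∀ j : ℕ, σ R * p ^ (j + 1) < σ R := fun j => by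
    have : p ^ (j + 1) < 1 := pow_lt_one₀ hp0.le hp1 (Nat.succ_ne_zero j)
    nlinarith
  have hpos : ∀ j : ℕ, 0 < σ R * p ^ (j + 1) := fun j => by positivity
  have hεpos : ∀ j : ℕ, 0 < inverseOn (Ioi 0) σ (σ R * p ^ (j + 1)) := fun j =>
    inverseOn_Ioi_pos hσ0 hσm hR (hpos j) (hlt j)
  choose T hTcard hT using fun j : ℕ => exists_net_card_eq_metricMassiveness (B := B) (hεpos j)
  choose π hπT hπd using hT
  have hchain := fun n : ℕ => lintegral_iSup_exp_le_of_chain hφ hY hβ0.le hp0 hp1 hl hY0 T π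
    hπT (fun j s => (hσY _ (hεpos j) _ _ (hπd j s)).mono hφ
      (nonneg_of_monotoneOn_of_tendsto hσm hσ0 (hεpos j))
      (apply_inverseOn_Ioi_le hσc hσ0 hσm hR (hpos j) (hlt j))) F n
  simp only [hTcard] at hchain
  set E := Real.exp ((1 - p) * φ (γ * (l / (1 - p))) + p * φ (σ R * (l / (1 - p))))
  have hlim : Tendsto (fun n : ℕ => ENNReal.ofReal (entropyFactor B σ r (σ R) p *
      (F.card : ℝ) ^ p ^ (n + 1) * E)) atTop
      (𝓝 (ENNReal.ofReal (entropyFactor B σ r (σ R) p * E))) := by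
    refine ENNReal.tendsto_ofReal ?_
    have h1 : Tendsto (fun n : ℕ => p ^ (n + 1)) atTop (𝓝 0) :=
      (tendsto_pow_atTop_nhds_zero_of_lt_one hp0.le hp1).comp (tendsto_add_atTop_nat 1)
    have hc : (F.card : ℝ) ≠ 0 := by exact_mod_cast hF.card_pos.ne'
    have h2 := ((Real.continuous_const_rpow hc).tendsto 0).comp h1
    rw [Real.rpow_zero] at h2
    simpa using (h2.const_mul (entropyFactor B σ r (σ R) p)).mul_const E
  -- The left side does not depend on `n`, and the factor `F.card ^ p ^ (n + 1)` tends to 1.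
  refine ge_of_tendsto' hlim fun n => (hchain n).trans (ENNReal.ofReal_le_ofReal ?_)
  have := prod_metricMassiveness_le_entropyFactor (B := B) hσm hσ0 hR hβ0 hrc hrm hrconv hent
    hp0 hp1 (n + 1)
  gcongr

end ExponentialMoment

/-! ### Tail bounds and optimization -/

section Tail

variable {Ω B : Type*} [MeasurableSpace Ω] {P : Measure Ω}

/-- Chernoff's bound for the supremum of a process over a countable set. -/
theorem measure_exists_lt_le {Y : B → Ω → ℝ} (hY : ∀ t, Measurable (Y t)) {l : ℝ} (hl : 0 ≤ l)
    {C : ℝ} (hC : ∀ F : Finset B,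
      ∫⁻ ω, ⨆ t ∈ F, ENNReal.ofReal (Real.exp (l * Y t ω)) ∂P ≤ ENNReal.ofReal C)
    {S : Set B} (hS : S.Countable) (x : ℝ) :
    P {ω | ∃ s ∈ S, x < Y s ω} ≤ ENNReal.ofReal (C * Real.exp (-(l * x))) := by
  classical
  have hfin : ∀ F : Finset B,
      P {ω | ∃ s ∈ F, x < Y s ω} ≤ ENNReal.ofReal (C * Real.exp (-(l * x))) := fun F => by
    have hm : Measurable fun ω => ⨆ t ∈ F, ENNReal.ofReal (Real.exp (l * Y t ω)) :=
      .biSup _ F.countable_toSet fun t _ => ((hY t).const_mul l).exp.ennreal_ofReal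
    have hmarkov := mul_meas_ge_le_lintegral (μ := P) hm (ENNReal.ofReal (Real.exp (l * x)))
    have hsub : {ω | ∃ s ∈ F, x < Y s ω} ⊆ {ω | ENNReal.ofReal (Real.exp (l * x)) ≤
        ⨆ t ∈ F, ENNReal.ofReal (Real.exp (l * Y t ω))} := by
      rintro ω ⟨s, hs, hlt⟩
      refine le_trans ?_ (le_biSup (fun t => ENNReal.ofReal (Real.exp (l * Y t ω))) hs)
      exact ENNReal.ofReal_le_ofReal
        (Real.exp_le_exp.2 (mul_le_mul_of_nonneg_left hlt.le hl))
    have hbound := (mul_le_mul_right (measure_mono hsub) _).trans (hmarkov.trans (hC F))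
    rw [Real.exp_neg, ← div_eq_mul_inv, ENNReal.ofReal_div_of_pos (Real.exp_pos _),
      ENNReal.le_div_iff_mul_le (.inl (by simpa using Real.exp_pos _))
      (.inl ENNReal.ofReal_ne_top), mul_comm]
    exact hbound
  rcases S.eq_empty_or_nonempty with rfl | hne
  · simp
  obtain ⟨s, rfl⟩ := hS.exists_eq_range hne
  have hunion : {ω | ∃ t ∈ range s, x < Y t ω} = ⋃ n, {ω | x < Y (s n) ω} := by
    ext ω
    simp
  -- The finite bound does not depend on `F`, so continuity along increasing unions passes it on
  -- without loss.
  rw [hunion, measure_iUnion_eq_iSup_accumulate]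
  refine iSup_le fun n => le_trans (measure_mono ?_) (hfin ((Finset.range (n + 1)).image s))
  intro ω hω
  obtain ⟨i, hi, hlt⟩ := mem_accumulate.1 hω
  exact ⟨s i, Finset.mem_image_of_mem s (Finset.mem_range.2 (Nat.lt_succ_of_le hi)), hlt⟩

/-- A process with a uniform exponential tail bound is almost surely bounded above. -/
theorem ae_exists_forall_le {Y : B → Ω → ℝ} {S : Set B} {C : ℝ}
    (h : ∀ x : ℝ, P {ω | ∃ s ∈ S, x < Y s ω} ≤ ENNReal.ofReal (C * Real.exp (-(1 * x)))) :
    ∀ᵐ ω ∂P, ∃ M : ℝ, ∀ s ∈ S, Y s ω ≤ M := by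
  rw [ae_iff]
  have hlim : Tendsto (fun x : ℝ => ENNReal.ofReal (C * Real.exp (-(1 * x)))) atTop (𝓝 0) := by
    have h1 := (Real.tendsto_exp_neg_atTop_nhds_zero.const_mul C)
    rw [mul_zero] at h1
    simpa using ENNReal.tendsto_ofReal h1
  refine le_antisymm (ge_of_tendsto' hlim fun x => le_trans (measure_mono fun ω hω => ?_) (h x))
    zero_le
  simp only [mem_ofPred_eq, not_exists, not_forall, not_le] at hω
  obtain ⟨s, hs, hlt⟩ := hω x
  exact ⟨s, hs, hlt⟩

end Tail

/-- The value of `A μ ^ ζ / ζ - μ y` at its minimizer `μ = (y / A) ^ (1 / (ζ - 1))`. -/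
theorem rpow_exponent_at_minimizer {ζ y A μ : ℝ} (hζ : 1 < ζ) (hy : 0 < y) (hA : 0 < A)
    (hμ : μ = (y / A) ^ (1 / (ζ - 1))) :
    A * μ ^ ζ / ζ - μ * y = (1 - ζ) * y ^ (ζ / (ζ - 1)) / (ζ * A ^ (1 / (ζ - 1))) := by
  have hζ1 : ζ - 1 ≠ 0 := (sub_pos.2 hζ).ne'
  have hμ0 : 0 < μ := by rw [hμ]; positivity
  -- The first-order condition; it turns `A μ ^ ζ` into `y μ`.
  have hpow : μ ^ (ζ - 1) = y / A := by
    rw [hμ, ← Real.rpow_mul (by positivity), one_div_mul_cancel hζ1, Real.rpow_one]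
  have hμζ : μ ^ ζ = y / A * μ := by
    rw [← hpow, ← Real.rpow_add_one hμ0.ne', sub_add_cancel]
  have hyζ : y ^ (ζ / (ζ - 1)) = y ^ (1 / (ζ - 1)) * y := by
    rw [← Real.rpow_add_one hy.ne']
    congr 1
    field_simp
    ring
  have hAq : 0 < A ^ (1 / (ζ - 1)) := by positivity
  rw [hμζ, hyζ, hμ, Real.div_rpow hy.le hA.le]
  field_simp

/-- Since `sInf ∅ = 0`, a bound on the standard of an increment carries information only once some
admissible constant exists. -/
theorem IsPhiSubGaussian.exists_expMomentBound_sub {Ω : Type*} [MeasurableSpace Ω]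
    {P : Measure Ω} {φ : ℝ → ℝ} (hφ : IsOrliczNFunction φ) {ξ η : Ω → ℝ}
    (hξ : IsPhiSubGaussian φ P ξ) (hη : IsPhiSubGaussian φ P η) :
    ∃ a : ℝ, 0 ≤ a ∧ ExpMomentBound φ P (fun ω => ξ ω - η ω) a := by
  obtain ⟨hξm, a, ha, hξa⟩ := hξ
  obtain ⟨hηm, b, hb, hηb⟩ := hη
  refine ⟨2 * max a b, by positivity, ?_⟩
  simpa only [sub_eq_add_neg] using ExpMomentBound.add hξm hηm.fun_neg
    (hξa.mono hφ ha (le_max_left a b)) ((hηb.neg hφ).mono hφ hb (le_max_right a b))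

/-- `X t` is `X s` plus an increment over a distance at most the diameter, for one fixed `s`.
Without boundedness the real supremum defining `γ` would default to 0. -/
theorem bddAbove_range_subGaussianStandard_rpow {Ω B : Type*} [MeasurableSpace Ω]
    [MetricSpace B] [CompactSpace B] [Nonempty B]
    {P : Measure Ω} {φ : ℝ → ℝ} (hφ : IsOrliczNFunction φ) {X : B → Ω → ℝ}
    (hX : ∀ t, IsPhiSubGaussian φ P (X t)) {σ : ℝ → ℝ} (hσnn : ∀ h : ℝ, 0 < h → 0 ≤ σ h)
    (hinc : ∀ h : ℝ, 0 < h → ∀ s t : B, dist t s ≤ h →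
      ExpMomentBound φ P (fun ω => X t ω - X s ω) (σ h)) {ζ : ℝ} (hζ : 0 ≤ ζ) :
    BddAbove (range fun u : B => subGaussianStandard φ P (X u) ^ ζ) := by
  obtain ⟨s⟩ := ‹Nonempty B›
  obtain ⟨hsm, a, ha, hsa⟩ := hX s
  set D := Metric.diam (univ : Set B) + 1
  have hD : 0 < D := by have := Metric.diam_nonneg (s := (univ : Set B)); positivity
  refine ⟨(2 * max (σ D) a) ^ ζ, ?_⟩
  rintro _ ⟨t, rfl⟩
  refine Real.rpow_le_rpow subGaussianStandard_nonneg
    (subGaussianStandard_le (by positivity) ?_) hζ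
  have hts : dist t s ≤ D := (Metric.dist_le_diam_of_mem isCompact_univ.isBounded
    (mem_univ t) (mem_univ s)).trans (le_add_of_nonneg_right zero_le_one)
  simpa only [sub_add_cancel] using ExpMomentBound.add ((hX t).1.fun_sub hsm) hsm
    ((hinc D hD s t hts).mono hφ (hσnn D hD) (le_max_left _ a)) (hsa.mono hφ ha (le_max_right _ a))

theorem entropyFactor_nonneg {B : Type*} [MetricSpace B] (σ r : ℝ → ℝ) (β p : ℝ) :
    0 ≤ entropyFactor B σ r β p :=
  Real.sSup_nonneg fun _ hh => zero_le_one.trans hh.1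

theorem tailBound_nonneg {B : Type*} [MetricSpace B] (σ r : ℝ → ℝ) (ζ γ β p x : ℝ) :
    0 ≤ tailBound B σ r ζ γ β p x :=
  mul_nonneg (Real.exp_pos _).le (entropyFactor_nonneg σ r β p)

/-- The exponential tail bound in terms of a parameter `μ` for which `φ` is a power at `γ μ` and
`β μ`, with the optimal choice of `μ`, is `tailBound`. -/
theorem exists_mul_exp_eq_tailBound {B : Type*} [MetricSpace B] {φ : ℝ → ℝ} {ζ : ℝ} (hζ : 2 ≤ ζ)
    (hφζ : ∀ t : ℝ, 1 < t → φ t = t ^ ζ / ζ) (σ r : ℝ → ℝ) {γ β p x : ℝ} (hγ0 : 0 ≤ γ)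
    (hβ0 : 0 < β) (hp0 : 0 < p) (hp1 : p < 1)
    (hx : γ ^ ζ * (1 - p) + p * β ^ ζ < x * ((1 - p) * min β γ ^ (ζ - 1))) :
    ∃ l : ℝ, 0 ≤ l ∧ entropyFactor B σ r β p *
        Real.exp ((1 - p) * φ (γ * (l / (1 - p))) + p * φ (β * (l / (1 - p)))) *
        Real.exp (-(l * x)) = tailBound B σ r ζ γ β p x := by
  have hq : 0 < 1 - p := sub_pos.2 hp1
  have hζ1 : 0 < ζ - 1 := by linarith
  set A := γ ^ ζ * (1 - p) + p * β ^ ζ with hA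
  have hA0 : 0 < A := by positivity
  have hv0 : 0 < min β γ := by
    rcases (le_min hβ0.le hγ0).eq_or_lt with h | h
    · rw [← h, Real.zero_rpow hζ1.ne', mul_zero, mul_zero] at hx
      exact absurd hx hA0.not_gt
    · exact h
  have hvp : 0 < (1 - p) * min β γ ^ (ζ - 1) := by positivity
  have hx0 : 0 < x := pos_of_mul_pos_left (hA0.trans hx) hvp.le
  have hγpos : 0 < γ := hv0.trans_le (min_le_right _ _)
  have hy : 0 < x * (1 - p) := mul_pos hx0 hq
  set μ := (x * (1 - p) / A) ^ (1 / (ζ - 1)) with hμ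
  have hμ0 : 0 < μ := by positivity
  have hpow : μ ^ (ζ - 1) = x * (1 - p) / A := by
    rw [hμ, ← Real.rpow_mul (by positivity), one_div_mul_cancel hζ1.ne', Real.rpow_one]
  -- Raised to the power `ζ - 1`, this is the assumed lower bound on `x`.
  have hvμ : 1 < min β γ * μ := by
    by_contra! hle
    have h1 := Real.rpow_le_one (by positivity) hle hζ1.le
    rw [Real.mul_rpow hv0.le hμ0.le, hpow, ← mul_div_assoc, div_le_one hA0] at h1
    nlinarith
  have hφγ := hφζ (γ * μ) (hvμ.trans_le (mul_le_mul_of_nonneg_right (min_le_right _ _) hμ0.le))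
  have hφβ := hφζ (β * μ) (hvμ.trans_le (mul_le_mul_of_nonneg_right (min_le_left _ _) hμ0.le))
  rw [Real.mul_rpow hγ0 hμ0.le] at hφγ
  rw [Real.mul_rpow hβ0.le hμ0.le] at hφβ
  -- Chosen so that `l / (1 - p) = μ`.
  refine ⟨μ * (1 - p), by positivity, ?_⟩
  rw [mul_div_cancel_right₀ μ hq.ne', mul_assoc, ← Real.exp_add, mul_comm, tailBound, ← hA,
    ← rpow_exponent_at_minimizer (by linarith) hy hA0 hμ, hφγ, hφβ, hA]
  congr 2
  ring

/-! ### The main theorem -/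

theorem theorem3
    {Ω : Type*} [MeasurableSpace Ω] (P : Measure Ω) [IsProbabilityMeasure P]
    {B : Type*} [MetricSpace B] [CompactSpace B] [Nontrivial B]
    -- the function `φ`
    (φ : ℝ → ℝ) (hφ : IsOrliczNFunction φ) (hQ : AssumptionQ φ)
    (ζ : ℝ) (hζ : 2 ≤ ζ) (hφζ : ∀ t : ℝ, 1 < t → φ t = t ^ ζ / ζ)
    -- a separable `φ`-sub-Gaussian process
    (X : B → Ω → ℝ) (hX : ∀ t, IsPhiSubGaussian φ P (X t)) (hsep : IsSeparableProcess P X)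
    -- the modulus `σ` of the increments, defined on `(0, ∞)`
    (σ : ℝ → ℝ) (hσc : ContinuousOn σ (Ioi 0)) (hσm : MonotoneOn σ (Ioi 0))
    (hσ0 : Tendsto σ (𝓝[>] 0) (𝓝 0))
    (hσX : ∀ h : ℝ, 0 < h → ∀ s t : B, dist t s ≤ h →
      subGaussianStandard φ P (fun ω => X t ω - X s ω) ≤ σ h)
    (β : ℝ) (hβ : β = σ (⨅ s : B, ⨆ t : B, dist t s)) (hβ0 : 0 < β)
    -- the invertible increasing function `r`, defined on `[1, ∞)`
    (r : ℝ → ℝ) (hrc : ContinuousOn r (Ici 1)) (hrm : StrictMonoOn r (Ici 1))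
    (hr0 : ∀ u : ℝ, 1 < u → 0 < r u)
    (hrconv : ConvexOn ℝ (Ioi 0) (fun t => r (Real.exp t)))
    -- the entropy integral over `(0, β)` is finite
    (hent : IntervalIntegrable (fun u => r (metricMassiveness B (inverseOn (Ioi 0) σ u)))
      volume 0 β)
    -- `γ ^ ζ` is the supremum of `τ_φ(X u) ^ ζ`
    (γ : ℝ) (hγ0 : 0 ≤ γ) (hγ : γ ^ ζ = ⨆ u : B, subGaussianStandard φ P (X u) ^ ζ) :
    (∀ᵐ ω ∂P, ∃ C : ℝ, ∀ t : B, |X t ω| ≤ C) ∧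
    ∀ p : ℝ, 0 < p → p < 1 → ∀ x : ℝ,
      -- `x > (γ ^ ζ (1 - p) + p β ^ ζ) / ((1 - p) v ^ (ζ - 1))` with `v = min β γ`,
      -- read as `x > ∞` if `v = 0`
      γ ^ ζ * (1 - p) + p * β ^ ζ < x * ((1 - p) * min β γ ^ (ζ - 1)) →
      P.real {ω | (x : EReal) < (⨆ t : B, (X t ω : EReal))} ≤ tailBound B σ r ζ γ β p x ∧
      P.real {ω | (⨅ t : B, (X t ω : EReal)) < ((-x : ℝ) : EReal)} ≤ tailBound B σ r ζ γ β p x ∧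
      P.real {ω | (x : EReal) < (⨆ t : B, ((|X t ω| : ℝ) : EReal))} ≤
        2 * tailBound B σ r ζ γ β p x := by
  subst hβ
  set R := ⨅ s : B, ⨆ t : B, dist t s
  have hR : 0 < R := radius_pos
  have hζ0 : 0 < ζ := by linarith
  have hσnn : ∀ h : ℝ, 0 < h → 0 ≤ σ h := fun h hh => nonneg_of_monotoneOn_of_tendsto hσm hσ0 hh
  have hinc : ∀ h : ℝ, 0 < h → ∀ s t : B, dist t s ≤ h →
      ExpMomentBound φ P (fun ω => X t ω - X s ω) (σ h) := fun h hh s t hst =>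
    (expMomentBound_subGaussianStandard hφ ((hX t).exists_expMomentBound_sub hφ (hX s))).mono hφ
      subGaussianStandard_nonneg (hσX h hh s t hst)
  have hXγ : ∀ t, ExpMomentBound φ P (X t) γ := fun t => by
    refine (expMomentBound_subGaussianStandard hφ (hX t).2).mono hφ subGaussianStandard_nonneg ?_
    rw [← Real.rpow_le_rpow_iff subGaussianStandard_nonneg hγ0 hζ0, hγ]
    exact le_ciSup (bddAbove_range_subGaussianStandard_rpow hφ hX hσnn hinc hζ0.le) t
  have hXm : ∀ t, Measurable (X t) := fun t => (hX t).1
  obtain ⟨S, hSc, -, N, hN, hsep⟩ := hsep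
  have hup : ∀ p : ℝ, 0 < p → p < 1 → ∀ l : ℝ, 0 ≤ l → ∀ x : ℝ,
      P {ω | ∃ s ∈ S, x < X s ω} ≤ ENNReal.ofReal (entropyFactor B σ r (σ R) p *
        Real.exp ((1 - p) * φ (γ * (l / (1 - p))) + p * φ (σ R * (l / (1 - p)))) *
        Real.exp (-(l * x))) := fun p hp0 hp1 l hl x =>
    measure_exists_lt_le hXm hl (lintegral_iSup_exp_le hφ hXm hp0 hp1 hl hXγ hσc hσm hσ0 hR hβ0
      hinc hrc hrm hrconv hent) hSc x
  -- The process `-X` satisfies the same moment bounds with the same `γ` and `σ`.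
  have hdown : ∀ p : ℝ, 0 < p → p < 1 → ∀ l : ℝ, 0 ≤ l → ∀ x : ℝ,
      P {ω | ∃ s ∈ S, x < -X s ω} ≤ ENNReal.ofReal (entropyFactor B σ r (σ R) p *
        Real.exp ((1 - p) * φ (γ * (l / (1 - p))) + p * φ (σ R * (l / (1 - p)))) *
        Real.exp (-(l * x))) := fun p hp0 hp1 l hl x =>
    measure_exists_lt_le (Y := fun t ω => -X t ω) (fun t => (hXm t).neg) hl
      (lintegral_iSup_exp_le hφ (fun t => (hXm t).neg) hp0 hp1 hl (fun t => (hXγ t).neg hφ)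
      hσc hσm hσ0 hR hβ0 (fun h hh s t hst => by
        convert (hinc h hh s t hst).neg hφ using 2 with ω
        simp only [Pi.neg_apply]
        ring) hrc hrm hrconv hent) hSc x
  refine ⟨?_, fun p hp0 hp1 x hx => ?_⟩
  -- Almost sure boundedness needs no optimization: any fixed `p` and `l > 0` would do.
  · filter_upwards [ae_exists_forall_le fun x => hup (1 / 2) (by norm_num) (by norm_num) 1
        zero_le_one x, ae_exists_forall_le (Y := fun t ω => -X t ω) fun x =>
        hdown (1 / 2) (by norm_num) (by norm_num) 1 zero_le_one x, measure_eq_zero_iff_ae_notMem.1 hN]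
      with ω ⟨M, hM⟩ ⟨M', hM'⟩ hω
    refine ⟨max M M', fun t => abs_le.2 (hsep univ isOpen_univ (Icc (-max M M') (max M M'))
      isClosed_Icc ω hω (fun s hs => ⟨?_, (hM s hs.2).trans (le_max_left _ _)⟩) t (mem_univ t))⟩
    linarith [hM' s hs.2, le_max_right M M']
  obtain ⟨l, hl, hlZ⟩ := exists_mul_exp_eq_tailBound (B := B) hζ hφζ σ r hγ0 hβ0 hp0 hp1 hx
  have hu := hup p hp0 hp1 l hl x
  have hd := hdown p hp0 hp1 l hl x
  rw [hlZ] at hu hd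
  have hZ := tailBound_nonneg (B := B) σ r ζ γ (σ R) p x
  have hsup : P.real {ω | (x : EReal) < (⨆ t : B, (X t ω : EReal))} ≤
      tailBound B σ r ζ γ (σ R) p x := by
    refine ENNReal.toReal_le_of_le_ofReal hZ (le_trans (measure_mono ?_) ((measure_union_le N
      {ω | ∃ s ∈ S, x < X s ω}).trans (by rw [hN, zero_add]; exact hu)))
    intro ω hω
    by_contra hcon
    simp only [mem_union, mem_ofPred_eq, not_or, not_exists, not_and, not_lt] at hcon
    -- Separability with `U = B` and the closed half-line `(-∞, x]`: outside `N`, a bound on `S` is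
    -- a bound on `B`.
    have hall := hsep univ isOpen_univ (Iic x) isClosed_Iic ω hcon.1 fun s hs => hcon.2 s hs.2
    exact hω.not_ge (iSup_le fun t => EReal.coe_le_coe_iff.2 (hall t (mem_univ t)))
  have hinf : P.real {ω | (⨅ t : B, (X t ω : EReal)) < ((-x : ℝ) : EReal)} ≤
      tailBound B σ r ζ γ (σ R) p x := by
    refine ENNReal.toReal_le_of_le_ofReal hZ (le_trans (measure_mono ?_) ((measure_union_le N
      {ω | ∃ s ∈ S, x < -X s ω}).trans (by rw [hN, zero_add]; exact hd)))
    intro ω hω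
    by_contra hcon
    simp only [mem_union, mem_ofPred_eq, not_or, not_exists, not_and, not_lt] at hcon
    have hall := hsep univ isOpen_univ (Ici (-x)) isClosed_Ici ω hcon.1 fun s hs =>
      neg_le.1 (hcon.2 s hs.2)
    exact hω.not_ge (le_iInf fun t => EReal.coe_le_coe_iff.2 (hall t (mem_univ t)))
  refine ⟨hsup, hinf, ?_⟩
  rw [two_mul]
  refine le_trans (measureReal_mono ?_) ((measureReal_union_le _ _).trans (add_le_add hsup hinf))
  intro ω hω
  obtain ⟨t, ht⟩ := lt_iSup_iff.1 (mem_ofPred_eq ▸ hω : (x : EReal) < _)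
  rcases lt_abs.1 (EReal.coe_lt_coe_iff.1 ht) with h | h
  · left
    rw [mem_ofPred_eq]
    exact lt_iSup_iff.2 ⟨t, EReal.coe_lt_coe_iff.2 h⟩
  · right
    rw [mem_ofPred_eq]
    exact iInf_lt_iff.2 ⟨t, EReal.coe_lt_coe_iff.2 (lt_neg_of_lt_neg h)⟩
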